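/- Let $\Phi$ be a totally ordered abelian group, $\Phi_+$ the set of its positive elements, and $r(\Phi)=\dim_{\mathbf Q}(\mathbf Q\otimes_{\mathbf Z}\Phi)$ its rational rank. For a commutative ring $A$, let $A[t^{\Phi_+}]$ be the algebra of the semigroup $\Phi_+\cup\{0\}$ with coefficients in $A$, with its natural grading. In an $A$-algebra graded by $\Phi_+\cup\{0\}$, a *graded polynomial subalgebra* is a subalgebra $A[x_1,\dots,x_n]$ generated by finitely many elements $x_1,\dots,x_n$ that are homogeneous of positive degree and algebraically independent over $A$. **(1)** Suppose that $\Phi$ has finite height, i.e. has only finitely many convex (isolated) subgroups. Then for every commutative ring $A$ there is a set $\mathcal S$ of graded polynomial subalgebras of $A[t^{\Phi_+}]$, each with variables of the form $t^{\phi}$, $\phi\in\Phi_+$, such that: $\mathcal S$ is nonempty and directed under inclusion; every inclusion between two members of $\mathcal S$ is toric (each variable of the smaller one is a monomial in the variables of the larger one); and $A[t^{\Phi_+}]$ is the direct limit (the union) of the members of $\mathcal S$. If moreover $\Phi$ is countable (for instance if $r(\Phi)<\infty$), there is a nested sequence $S_0\subset S_1\subset S_2\subset\cdots$ of members of $\mathcal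 S$ that is cofinal in $\mathcal S$. If $r(\Phi)$ is finite, $\mathcal S$ can be chosen with these properties and such that all its members have exactly $r(\Phi)$ variables. **(2)** Suppose that $r(\Phi)$ is finite, and let $\nu\colon K^*\to\Phi$ be a valuation of a field $K$ with value group $\Phi$, with valuation ring $R_\nu$ and residue field $k_\nu$. Set $\mathcal P_\phi=\{x\in R_\nu\mid \nu(x)\ge\phi\}$, $\mathcal P_\phi^+=\{x\in R_\nu\mid\nu(x)>\phi\}$ and let $\mathrm{gr}_\nu R_\nu=\bigoplus_{\phi\in\Phi_+\cup\{0\}}\mathcal P_\phi/\mathcal P_\phi^+$, a graded $k_\nu$-algebra. Then: (a) $\mathrm{gr}_\nu R_\nu$ is, as a graded $k_\nu$-algebra, a quotient of a polynomial ring $k_\nu[(V_j)_{j\in J}]$ in countably many (possibly finitely many) variables, graded by giving each $V_j$ a degree in $\Phi_+$, by an ideal generated by homogeneous binomials $(V_j-\lambda_jV^{m(j)})_{j\in J'}$, where $J'\subset J$, $\lambda_j\in k_\nu^*$ and each $V^{m(j)}$ is a monomial of total exponent $|m(j)|\ge 2$. (b) $\mathrm{gr}_\nu R_\nu$ is the union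 of a nested sequence $(k_\nu[x^{(h)}_1,\dots,x^{(h)}_{r(\Phi)}])_{h\ge 0}$ of graded polynomial subalgebras over $k_\nu$ in $r(\Phi)$ variables, such that each $x_i^{(h)}$ equals a nonzero constant of $k_\nu$ times a monomial in $x^{(h+1)}_1,\dots,x^{(h+1)}_{r(\Phi)}$. -/

import Mathlib

open scoped TensorProduct DirectSum

noncomputable section

namespace ValGr

/-! ### Totally ordered abelian groups -/

section Groups

variable (Φ : Type*) [AddCommGroup Φ] [LinearOrder Φ]

/-- The totally ordered group `Φ` has finite height: it has only finitely many isolated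
(that is, convex) subgroups. -/
def FiniteHeight : Prop :=
  {H : AddSubgroup Φ | (H : Set Φ).OrdConnected}.Finite

/-- The vector space `ℚ ⊗ Φ` has finite dimension over `ℚ`. -/
def FiniteRationalRank (Φ : Type*) [AddCommGroup Φ] : Prop :=
  Module.Finite ℚ (ℚ ⊗[ℤ] Φ)

/-- The rational rank `r(Φ)`: the dimension of the `ℚ`-vector space `ℚ ⊗ Φ`
(meaningful when that dimension is finite). -/
def rationalRank (Φ : Type*) [AddCommGroup Φ] : ℕ :=
  Module.finrank ℚ (ℚ ⊗[ℤ] Φ)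

/-- The semigroup `Φ₊ ∪ {0}` of nonnegative elements of `Φ`. -/
abbrev NonnegPart : Type _ := {φ : Φ // 0 ≤ φ}

end Groups

/-! ### Graded polynomial subalgebras -/

section Polynomial

variable {Φ : Type*} [AddCommGroup Φ] [LinearOrder Φ] [IsOrderedAddMonoid Φ]
variable {A B : Type*} [CommRing A] [CommRing B] [Algebra A B]

/-- A graded polynomial subalgebra (with chosen variables) of an `A`-algebra `B` graded by
`Φ₊ ∪ {0}` with homogeneous components `comp φ`: finitely many elements `x₁, …, xₙ` of `B`,
algebraically independent over `A` and homogeneous of positive degrees. The subalgebra itself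
is `A[x₁, …, xₙ]`, see `toSubalgebra`. -/
structure GradedPolySubalgebra (A : Type*) {B : Type*} [CommRing A] [CommRing B] [Algebra A B]
    (comp : NonnegPart Φ → AddSubgroup B) where
  /-- the number of variables -/
  n : ℕ
  /-- the variables -/
  x : Fin n → B
  /-- the degrees of the variables -/
  deg : Fin n → NonnegPart Φ
  deg_pos : ∀ i, 0 < deg i
  x_mem : ∀ i, x i ∈ comp (deg i)
  algInd : AlgebraicIndependent A x

variable {comp : NonnegPart Φ → AddSubgroup B}

/-- The subalgebra `A[x₁, …, xₙ]` of `B`; as the `xᵢ` are algebraically independent, it is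
isomorphic to the polynomial ring in `n` variables over `A`. -/
def GradedPolySubalgebra.toSubalgebra (S : GradedPolySubalgebra A comp) : Subalgebra A B :=
  Algebra.adjoin A (Set.range S.x)

/-- Each variable of `S` is a monomial in the variables of `T`: the inclusion of the first
polynomial algebra in the second one is toric. -/
def ToricInclusion (S T : GradedPolySubalgebra A comp) : Prop :=
  S.toSubalgebra ≤ T.toSubalgebra ∧
    ∀ i, ∃ m : Fin T.n → ℕ, S.x i = ∏ j, T.x j ^ m j

/-- Each variable of `S` is a nonzero constant (a unit of `A`) times a monomial in the
variables of `T`. -/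
def TermInclusion (S T : GradedPolySubalgebra A comp) : Prop :=
  S.toSubalgebra ≤ T.toSubalgebra ∧
    ∀ i, ∃ (c : Aˣ) (m : Fin T.n → ℕ), S.x i = (c : A) • ∏ j, T.x j ^ m j

/-- A set `𝒮` of graded polynomial subalgebras of `B`, ordered by inclusion, is a direct system
with toric transition maps, and `B` is its direct limit (that is, `𝒮` is nonempty, directed under
inclusion, and its union is `B`). -/
structure IsToricDirectLimit (𝒮 : Set (GradedPolySubalgebra A comp)) : Prop where
  nonempty : 𝒮.Nonempty
  directed : ∀ S ∈ 𝒮, ∀ T ∈ 𝒮, ∃ U ∈ 𝒮,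
    S.toSubalgebra ≤ U.toSubalgebra ∧ T.toSubalgebra ≤ U.toSubalgebra
  toric : ∀ S ∈ 𝒮, ∀ T ∈ 𝒮, S.toSubalgebra ≤ T.toSubalgebra → ToricInclusion S T
  union : ∀ b : B, ∃ S ∈ 𝒮, b ∈ S.toSubalgebra

/-- The graded `A`-algebra `B` is the quotient of a polynomial ring `A[(V_j)_{j ∈ J}]` in countably
many variables, graded by giving to `V_j` the degree `deg j > 0`, by the ideal generated by
homogeneous binomials `V_j - λ_j V^{m(j)}`, one for each `j` in a subset `J'` of `J`, with
`λ_j` a unit of `A` and `|m(j)| ≥ 2`. -/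
def HasBinomialPresentation (A : Type*) {B : Type*} [CommRing A] [CommRing B] [Algebra A B]
    (comp : NonnegPart Φ → AddSubgroup B) : Prop :=
  ∃ (J : Type) (_ : Countable J) (deg : J → NonnegPart Φ) (π : MvPolynomial J A →ₐ[A] B)
    (J' : Set J) (lam : J → Aˣ) (m : J → J →₀ ℕ),
    (∀ j, 0 < deg j) ∧
    (∀ j, π (MvPolynomial.X j) ∈ comp (deg j)) ∧
    Function.Surjective π ∧
    (∀ j ∈ J', 2 ≤ (m j).sum fun _ e => e) ∧
    (∀ j ∈ J', ((m j).sum fun i e => e • deg i) = deg j) ∧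
    RingHom.ker π = Ideal.span
      {f | ∃ j ∈ J', f = MvPolynomial.X j - MvPolynomial.monomial (m j) (lam j : A)}

end Polynomial

/-! ### Semigroup algebras -/

section SemigroupAlgebra

/-- The algebra `A[t^{Φ₊}]` of the semigroup `Φ₊ ∪ {0}` with coefficients in `A`. -/
abbrev SemigroupAlgebra (A Φ : Type*) [CommRing A] [AddCommGroup Φ] [LinearOrder Φ]
    [IsOrderedAddMonoid Φ] : Type _ :=
  AddMonoidAlgebra A (NonnegPart Φ)

/-- The homogeneous component `A t^φ` of `A[t^{Φ₊}]`. -/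
def semigroupComp (A Φ : Type*) [CommRing A] [AddCommGroup Φ] [LinearOrder Φ]
    [IsOrderedAddMonoid Φ] (φ : NonnegPart Φ) : AddSubgroup (SemigroupAlgebra A Φ) :=
  (AddMonoidAlgebra.grade A φ).toAddSubgroup

end SemigroupAlgebra

/-! ### The valuation ring and its graded algebra -/

section Valuation

variable {K Φ : Type*} [Field K] [AddCommGroup Φ] [LinearOrder Φ] [IsOrderedAddMonoid Φ]
variable (ν : AddValuation K (WithTop Φ))

/-- The valuation ring `R_ν = {x ∈ K | ν(x) ≥ 0}`. -/
def valRing : ValuationSubring K where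
  carrier := {x | 0 ≤ ν x}
  mul_mem' {a b} ha hb := by
    change 0 ≤ ν (a * b)
    rw [ν.map_mul]
    exact add_nonneg ha hb
  one_mem' := by simp
  add_mem' ha hb := ν.map_le_add ha hb
  zero_mem' := by simp
  neg_mem' {a} ha := by
    change 0 ≤ ν (-a)
    rwa [ν.map_neg]
  mem_or_inv_mem' x := by
    rcases eq_or_ne x 0 with rfl | hx
    · left; simp
    · rcases le_total 0 (ν x) with h | h
      · exact Or.inl h
      · right
        have h1 : ν x + ν x⁻¹ = 0 := by rw [← ν.map_mul, mul_inv_cancel₀ hx, ν.map_one]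
        have h2 : ν x + ν x⁻¹ ≤ 0 + ν x⁻¹ := by gcongr
        rw [h1, zero_add] at h2
        exact h2

theorem mem_valRing {x : K} : x ∈ valRing ν ↔ 0 ≤ ν x := Iff.rfl

/-- The residue field `k_ν = R_ν / m_ν`. -/
abbrev ResField : Type _ := IsLocalRing.ResidueField (valRing ν)

/-- The valuation ideal `P_φ(R_ν) = {x ∈ R_ν | ν(x) ≥ φ}`. -/
def valIdeal (φ : NonnegPart Φ) : Ideal (valRing ν) where
  carrier := {x | ((φ : Φ) : WithTop Φ) ≤ ν x}
  add_mem' ha hb := ν.map_le_add ha hb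
  zero_mem' := by simp
  smul_mem' c x hx := by
    change ((φ : Φ) : WithTop Φ) ≤ ν ((c : K) * x)
    rw [ν.map_mul, ← zero_add ((φ : Φ) : WithTop Φ)]
    exact add_le_add c.2 hx

/-- The valuation ideal `P_φ⁺(R_ν) = {x ∈ R_ν | ν(x) > φ}`. -/
def valIdealSucc (φ : NonnegPart Φ) : Ideal (valRing ν) where
  carrier := {x | ((φ : Φ) : WithTop Φ) < ν x}
  add_mem' ha hb := ν.map_lt_add ha hb
  zero_mem' := by simp
  smul_mem' c x hx := by
    change ((φ : Φ) : WithTop Φ) < ν ((c : K) * x)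
    rw [ν.map_mul]
    have hc : (0 : WithTop Φ) ≤ ν (c : K) := c.2
    exact lt_of_lt_of_le hx (le_add_of_nonneg_left hc)

theorem mem_valIdeal {φ : NonnegPart Φ} {x : valRing ν} :
    x ∈ valIdeal ν φ ↔ ((φ : Φ) : WithTop Φ) ≤ ν x := Iff.rfl

theorem mem_valIdealSucc {φ : NonnegPart Φ} {x : valRing ν} :
    x ∈ valIdealSucc ν φ ↔ ((φ : Φ) : WithTop Φ) < ν x := Iff.rfl

/-- The homogeneous component `P_φ(R_ν) / P_φ⁺(R_ν)`. -/
def GrComp (φ : NonnegPart Φ) : Type _ :=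
  valIdeal ν φ ⧸ (valIdealSucc ν φ).submoduleOf (valIdeal ν φ)

instance (φ : NonnegPart Φ) : AddCommGroup (GrComp ν φ) :=
  inferInstanceAs
    (AddCommGroup (valIdeal ν φ ⧸ (valIdealSucc ν φ).submoduleOf (valIdeal ν φ)))

/-- The class of an element of `P_φ(R_ν)` in the component of degree `φ`. -/
def grMk (φ : NonnegPart Φ) (x : valIdeal ν φ) : GrComp ν φ := Submodule.Quotient.mk x

theorem grMk_surj {φ : NonnegPart Φ} (a : GrComp ν φ) : ∃ x, grMk ν φ x = a :=
  Submodule.Quotient.mk_surjective _ a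

theorem grMk_eq {φ : NonnegPart Φ} {x y : valIdeal ν φ} :
    grMk ν φ x = grMk ν φ y ↔ ((φ : Φ) : WithTop Φ) < ν ((x : K) - y) :=
  (Submodule.Quotient.eq _).trans Iff.rfl

theorem mul_mem_valIdeal {φ ψ : NonnegPart Φ} (x : valIdeal ν φ) (y : valIdeal ν ψ) :
    (x : valRing ν) * (y : valRing ν) ∈ valIdeal ν (φ + ψ) := by
  change (((φ : Φ) + (ψ : Φ) : Φ) : WithTop Φ) ≤ ν (((x : valRing ν) : K) * ((y : valRing ν) : K))
  rw [ν.map_mul, WithTop.coe_add]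
  exact add_le_add x.2 y.2

/-- The product of two homogeneous components, induced by the product of `R_ν`. -/
def grMul {φ ψ : NonnegPart Φ} (a : GrComp ν φ) (b : GrComp ν ψ) : GrComp ν (φ + ψ) :=
  Quotient.map₂ (fun (x : valIdeal ν φ) (y : valIdeal ν ψ) =>
      (⟨(x : valRing ν) * (y : valRing ν), mul_mem_valIdeal ν x y⟩ : valIdeal ν (φ + ψ)))
    (by
      intro (x : valIdeal ν φ) (x' : valIdeal ν φ) hx (y : valIdeal ν ψ) (y' : valIdeal ν ψ) hy
      have hx' := (grMk_eq ν).1 (Quotient.sound hx : grMk ν φ x = grMk ν φ x')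
      have hy' := (grMk_eq ν).1 (Quotient.sound hy : grMk ν ψ y = grMk ν ψ y')
      refine Quotient.exact ((grMk_eq ν (φ := φ + ψ)).2 ?_)
      change (((φ : Φ) + (ψ : Φ) : Φ) : WithTop Φ) <
        ν (((x : valRing ν) : K) * ((y : valRing ν) : K) -
          ((x' : valRing ν) : K) * ((y' : valRing ν) : K))
      have e : ((x : valRing ν) : K) * ((y : valRing ν) : K) -
          ((x' : valRing ν) : K) * ((y' : valRing ν) : K) =
          (((x : valRing ν) : K) - ((x' : valRing ν) : K)) * ((y : valRing ν) : K) +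
          ((x' : valRing ν) : K) * (((y : valRing ν) : K) - ((y' : valRing ν) : K)) := by ring
      rw [e, WithTop.coe_add]
      apply ν.map_lt_add
      · rw [ν.map_mul]
        exact WithTop.add_lt_add_of_lt_of_le WithTop.coe_ne_top hx' y.2
      · rw [ν.map_mul]
        exact WithTop.add_lt_add_of_le_of_lt WithTop.coe_ne_top x'.2 hy') a b

theorem grMul_mk {φ ψ : NonnegPart Φ} (x : valIdeal ν φ) (y : valIdeal ν ψ) :
    grMul ν (grMk ν φ x) (grMk ν ψ y) =
      grMk ν (φ + ψ) ⟨(x : valRing ν) * (y : valRing ν), mul_mem_valIdeal ν x y⟩ := rfl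

/-- Elements of `R_ν`, seen in `P_0(R_ν) = R_ν`. -/
def toZero (x : valRing ν) : valIdeal ν 0 := ⟨x, x.2⟩

theorem grMk_heq {φ ψ : NonnegPart Φ} (h : φ = ψ) (x : valIdeal ν φ) (y : valIdeal ν ψ)
    (hxy : (x : valRing ν) = (y : valRing ν)) :
    (⟨φ, grMk ν φ x⟩ : GradedMonoid (GrComp ν)) = ⟨ψ, grMk ν ψ y⟩ := by
  subst h
  rw [Subtype.ext hxy]

instance : GradedMonoid.GMul (GrComp ν) where
  mul := grMul ν

instance : GradedMonoid.GOne (GrComp ν) where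
  one := grMk ν 0 (toZero ν 1)

instance grCommMonoid : GradedMonoid.GCommMonoid (GrComp ν) where
  one_mul := by
    rintro ⟨φ, a⟩
    obtain ⟨x, rfl⟩ := grMk_surj ν a
    exact grMk_heq ν (zero_add φ) _ _ (one_mul (x : valRing ν))
  mul_one := by
    rintro ⟨φ, a⟩
    obtain ⟨x, rfl⟩ := grMk_surj ν a
    exact grMk_heq ν (add_zero φ) _ _ (mul_one (x : valRing ν))
  mul_assoc := by
    rintro ⟨φ, a⟩ ⟨ψ, b⟩ ⟨χ, c⟩
    obtain ⟨x, rfl⟩ := grMk_surj ν a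
    obtain ⟨y, rfl⟩ := grMk_surj ν b
    obtain ⟨z, rfl⟩ := grMk_surj ν c
    exact grMk_heq ν (add_assoc φ ψ χ) _ _ (mul_assoc (x : valRing ν) y z)
  mul_comm := by
    rintro ⟨φ, a⟩ ⟨ψ, b⟩
    obtain ⟨x, rfl⟩ := grMk_surj ν a
    obtain ⟨y, rfl⟩ := grMk_surj ν b
    exact grMk_heq ν (add_comm φ ψ) _ _ (mul_comm (x : valRing ν) y)

instance grCommRing : DirectSum.GCommRing (GrComp ν) where
  __ := grCommMonoid ν
  mul_zero a := by
    obtain ⟨x, rfl⟩ := grMk_surj ν a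
    exact congrArg (grMk ν _) (Subtype.ext (mul_zero (x : valRing ν)))
  zero_mul a := by
    obtain ⟨x, rfl⟩ := grMk_surj ν a
    exact congrArg (grMk ν _) (Subtype.ext (zero_mul (x : valRing ν)))
  mul_add a b c := by
    obtain ⟨x, rfl⟩ := grMk_surj ν a
    obtain ⟨y, rfl⟩ := grMk_surj ν b
    obtain ⟨z, rfl⟩ := grMk_surj ν c
    exact congrArg (grMk ν _) (Subtype.ext (mul_add (x : valRing ν) y z))
  add_mul a b c := by
    obtain ⟨x, rfl⟩ := grMk_surj ν a
    obtain ⟨y, rfl⟩ := grMk_surj ν b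
    obtain ⟨z, rfl⟩ := grMk_surj ν c
    exact congrArg (grMk ν _) (Subtype.ext (add_mul (x : valRing ν) y z))
  natCast n := grMk ν 0 (toZero ν n)
  natCast_zero := congrArg (grMk ν 0) (Subtype.ext Nat.cast_zero)
  natCast_succ n := congrArg (grMk ν 0) (Subtype.ext (Nat.cast_succ n))
  intCast n := grMk ν 0 (toZero ν n)
  intCast_ofNat n := congrArg (grMk ν 0) (Subtype.ext (Int.cast_natCast n))
  intCast_negSucc_ofNat n := congrArg (grMk ν 0) (Subtype.ext (Int.cast_negSucc n))

/-- The graded algebra `gr_ν R_ν = ⨁_φ P_φ(R_ν) / P_φ⁺(R_ν)`, over `φ ∈ Φ₊ ∪ {0}`. -/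
abbrev GrRing : Type _ := ⨁ φ : NonnegPart Φ, GrComp ν φ

/-- The homogeneous component of degree `φ` of `gr_ν R_ν`, as a subgroup. -/
def grComp (φ : NonnegPart Φ) : AddSubgroup (GrRing ν) :=
  (DirectSum.of (GrComp ν) φ).range

/-- The ring map `R_ν → gr_ν R_ν` sending `x` to its class in degree `0`. -/
def toGr : valRing ν →+* GrRing ν where
  toFun x := DirectSum.of (GrComp ν) 0 (grMk ν 0 (toZero ν x))
  map_one' := rfl
  map_mul' x y := by
    rw [DirectSum.of_mul_of]
    exact DirectSum.of_eq_of_gradedMonoid_eq (grMk_heq ν (zero_add 0).symm _ _ rfl)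
  map_zero' := (DirectSum.of (GrComp ν) 0).map_zero
  map_add' x y := (DirectSum.of (GrComp ν) 0).map_add
    (grMk ν 0 (toZero ν x)) (grMk ν 0 (toZero ν y))

theorem toGr_eq_zero {x : valRing ν} (hx : x ∈ IsLocalRing.maximalIdeal (valRing ν)) :
    toGr ν x = 0 := by
  have hpos : (0 : WithTop Φ) < ν (x : K) := by
    refine lt_of_le_of_ne x.2 fun h0 => ?_
    have hx0 : (x : K) ≠ 0 := by
      intro h
      rw [h, ν.map_zero] at h0
      exact WithTop.coe_ne_top h0
    have h1 : ν (x : K) + ν (x : K)⁻¹ = 0 := by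
      rw [← ν.map_mul, mul_inv_cancel₀ hx0, ν.map_one]
    rw [← h0, zero_add] at h1
    have hu : IsUnit x := IsUnit.of_mul_eq_one ⟨(x : K)⁻¹, h1.ge⟩
      (Subtype.ext (mul_inv_cancel₀ hx0))
    exact (IsLocalRing.mem_maximalIdeal x).1 hx hu
  have h2 : grMk ν 0 (toZero ν x) = grMk ν 0 0 := by
    rw [grMk_eq]
    change (0 : WithTop Φ) < ν ((x : K) - 0)
    rwa [sub_zero]
  change DirectSum.of (GrComp ν) 0 (grMk ν 0 (toZero ν x)) = 0
  rw [h2]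
  exact (DirectSum.of (GrComp ν) 0).map_zero

/-- The structure of `k_ν`-algebra of `gr_ν R_ν`, through `k_ν = R_ν/m_ν = P_0/P_0⁺`. -/
instance grAlgebra : Algebra (ResField ν) (GrRing ν) :=
  (Ideal.Quotient.lift (IsLocalRing.maximalIdeal (valRing ν)) (toGr ν)
    fun _ hx => toGr_eq_zero ν hx : ResField ν →+* GrRing ν).toAlgebra

end Valuation

end ValGr

end

noncomputable section

namespace ValGr

/-! ### Free submonoids in a totally ordered group: a Euclidean algorithm. -/

section Order

section OrderedGroups

variable {Φ : Type*} [AddCommGroup Φ]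

/-! Everything rests on one fact about `Φ`: a finite set of nonnegative elements lies in a submonoid
freely generated by finitely many ℤ-independent positive elements. A nontrivial relation `∑ cᵢ xᵢ =
0` between positive elements has coefficients of both signs. Replacing the larger of two elements
with opposite signs by their difference keeps the old elements in the generated monoid and makes the
relation simpler, until two elements coincide and one becomes zero
(`exists_nonneg_zero_of_relation`). Dropping zeros and repeating gives independence
(`exists_linearIndependent_pos`). Throwing in `r(Φ)` independent positive elements forces exactly
`r(Φ)` generators (`exists_posFamily`). So `Φ₊ ∪ {0}` is a directed union of free monoids, and a
nested one if `Φ` is countable (`exists_monotone_posFamily`).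

Both algebras have a basis with one homogeneous element per degree, multiplicative up to units
(`TermBasis`): the `t^φ`, or the classes of elements of value `φ`. Each free monoid then gives a
polynomial subalgebra, and inclusions of monoids give inclusions by terms. For the presentation
(`TermBasis.hasBinomialPresentation`), take a variable for each positive degree and a binomial for
each degree that becomes decomposable at some stage of the nested sequence, written at the first
such stage. Modulo these binomials each stage lies in the next, and algebraic independence at each
stage shows that nothing else is in the kernel. -/

theorem sum_update_smul_update {ι : Type*} [Fintype ι] [DecidableEq ι] (c : ι → ℤ) (x : ι → Φ)
    {i j : ι} (hij : i ≠ j) :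
    ∑ k, Function.update c j (c j + c i) k • Function.update x i (x i - x j) k =
      ∑ k, c k • x k := by
  have key : ∀ k, Function.update c j (c j + c i) k • Function.update x i (x i - x j) k =
      c k • x k + ((if k = j then c i • x j else 0) - if k = i then c i • x j else 0) := by
    intro k
    by_cases hi : k = i
    · subst hi
      simp [hij, sub_eq_add_neg]
    · by_cases hj : k = j
      · subst hj
        simp [hi, add_smul]
      · simp [hi, hj]
  simp [key, Finset.sum_add_distrib, Finset.sum_sub_distrib]

/-- Since `x i = (x i - x j) + x j`, a subtraction loses nothing of the generated monoid. -/
theorem mem_closure_range_of_update {ι : Type*} [DecidableEq ι] {x y : ι → Φ} {i j : ι}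
    (hij : i ≠ j)
    (h : ∀ k, Function.update x i (x i - x j) k ∈ AddSubmonoid.closure (Set.range y)) (k : ι) :
    x k ∈ AddSubmonoid.closure (Set.range y) := by
  by_cases hk : k = i
  · subst hk
    have h1 := h k
    have h2 := h j
    rw [Function.update_self] at h1
    rw [Function.update_of_ne hij.symm] at h2
    simpa using add_mem h1 h2
  · simpa [hk] using h k

variable [LinearOrder Φ] [IsOrderedAddMonoid Φ]

/-- The Euclidean step: a linear relation between positive elements makes it possible to replace
them by as many nonnegative elements, one of which is zero. -/
theorem exists_nonneg_zero_of_relation_bounded {ι : Type*} [Fintype ι] (M : ℕ) :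
    ∀ (x : ι → Φ) (c : ι → ℤ), (∀ i, 0 < x i) → c ≠ 0 → (∀ i, |c i| ≤ M) →
      ∑ i, c i • x i = 0 →
      ∃ y : ι → Φ, (∀ i, 0 ≤ y i) ∧ (∃ i, y i = 0) ∧
        ∀ i, x i ∈ AddSubmonoid.closure (Set.range y) := by
  classical
  induction M with
  | zero =>
    intro x c _ hc hM _
    exact absurd (funext fun i => by simpa using hM i) hc
  | succ M ihM =>
    -- Lexicographic descent on three counters: the bound on `|c i|`, the number of indices
    -- attaining it, and the number of negative coefficients.
    suffices H : ∀ (cnt : ℕ) (x : ι → Φ) (c : ι → ℤ), (∀ i, 0 < x i) → c ≠ 0 →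
        (∀ i, |c i| ≤ (M + 1 : ℕ)) → ∑ i, c i • x i = 0 →
        (Finset.univ.filter fun i => |c i| = (M + 1 : ℕ)).card ≤ cnt →
        ∃ y : ι → Φ, (∀ i, 0 ≤ y i) ∧ (∃ i, y i = 0) ∧
          ∀ i, x i ∈ AddSubmonoid.closure (Set.range y) from
      fun x c hx hc hM hrel => H _ x c hx hc hM hrel le_rfl
    intro cnt
    induction cnt with
    | zero =>
      intro x c hx hc hM hrel hcnt
      refine ihM x c hx hc (fun i => ?_) hrel
      have h1 : i ∉ Finset.univ.filter fun i => |c i| = (M + 1 : ℕ) := by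
        rw [Finset.card_eq_zero.1 (Nat.le_zero.1 hcnt)]
        simp
      have h2 := hM i
      simp only [Finset.mem_filter, Finset.mem_univ, true_and] at h1
      push_cast at h1 h2
      omega
    | succ cnt ihc =>
      intro x c hx hc hM hrel hcnt
      by_cases hex : ∃ i, |c i| = (M + 1 : ℕ)
      swap
      · refine ihM x c hx hc (fun i => ?_) hrel
        have h1 := hM i
        have h2 : |c i| ≠ (M + 1 : ℕ) := fun h => hex ⟨i, h⟩
        push_cast at h1 h2
        omega
      obtain ⟨i₀, hi₀⟩ := hex
      -- Up to changing the sign of the relation, the extremal coefficient is positive. It stays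
      -- fixed at `i₀` while the third counter decreases.
      suffices H : ∀ (neg : ℕ) (x : ι → Φ) (c : ι → ℤ), (∀ i, 0 < x i) →
          c i₀ = (M + 1 : ℕ) → (∀ i, |c i| ≤ (M + 1 : ℕ)) → ∑ i, c i • x i = 0 →
          (Finset.univ.filter fun i => |c i| = (M + 1 : ℕ)).card ≤ cnt + 1 →
          (Finset.univ.filter fun i => c i < 0).card ≤ neg →
          ∃ y : ι → Φ, (∀ i, 0 ≤ y i) ∧ (∃ i, y i = 0) ∧
            ∀ i, x i ∈ AddSubmonoid.closure (Set.range y) by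
        rcases eq_or_eq_neg_of_abs_eq hi₀ with h | h
        · exact H _ x c hx h hM hrel hcnt le_rfl
        · exact H _ x (-c) hx (by simp [h]) (by simpa using hM) (by simpa using hrel)
            (by simpa using hcnt) le_rfl
      intro neg
      induction neg with
      | zero =>
        intro x c hx h0 hM hrel _ hneg
        have hnn : ∀ i, 0 ≤ c i := by
          intro i
          have : i ∉ Finset.univ.filter fun i => c i < 0 := by
            rw [Finset.card_eq_zero.1 (Nat.le_zero.1 hneg)]
            simp
          simpa using this
        have h1 := (Finset.sum_eq_zero_iff_of_nonneg
          fun i _ => zsmul_nonneg (hx i).le (hnn i)).1 hrel i₀ (Finset.mem_univ _)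
        have h2 : 0 < c i₀ • x i₀ := zsmul_pos (hx i₀) (by rw [h0]; positivity)
        exact absurd h1 h2.ne'
      | succ neg ihn =>
        intro x c hx h0 hM hrel hcnt hneg
        have hex : ∃ j, c j < 0 := by
          by_contra! hnn
          have h1 := (Finset.sum_eq_zero_iff_of_nonneg
            fun i _ => zsmul_nonneg (hx i).le (hnn i)).1 hrel i₀ (Finset.mem_univ _)
          have h2 : 0 < c i₀ • x i₀ := zsmul_pos (hx i₀) (by rw [h0]; positivity)
          exact absurd h1 h2.ne'
        obtain ⟨j, hj⟩ := hex
        have hne : i₀ ≠ j := by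
          rintro rfl
          rw [h0] at hj
          omega
        have hMj := abs_le.1 (hM j)
        rcases lt_trichotomy (x i₀) (x j) with hlt | heq | hgt
        -- Rewrite the two terms as `(c i₀ + c j) x i₀ + c j (x j - x i₀)`. As `-(M + 1) ≤ c j < 0`,
        -- the index `i₀` is no longer extremal; the unchanged `c j` keeps the relation nontrivial.
        · obtain ⟨y, hy0, hy1, hy2⟩ := ihc (Function.update x j (x j - x i₀))
            (Function.update c i₀ (c i₀ + c j))
            (fun k => by
              by_cases hk : k = j
              · subst hk; simpa using hlt
              · simpa [hk] using hx k)
            (fun h => hj.ne (by simpa [hne.symm] using congrFun h j))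
            (fun k => by
              by_cases hk : k = i₀
              · subst hk
                rw [Function.update_self, abs_le]
                omega
              · simpa [hk] using hM k)
            ((sum_update_smul_update c x hne.symm).trans hrel)
            (by
              refine Nat.lt_succ_iff.1 (lt_of_lt_of_le (Finset.card_lt_card ?_) hcnt)
              rw [Finset.ssubset_iff_of_subset]
              · refine ⟨i₀, by simp [h0]; omega, ?_⟩
                simp only [Finset.mem_filter, Finset.mem_univ, true_and, Function.update_self]
                rw [abs_of_nonneg] <;> omega
              · intro k
                simp only [Finset.mem_filter, Finset.mem_univ, true_and]
                by_cases hk : k = i₀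
                · subst hk
                  intro _
                  rw [h0, abs_of_nonneg]
                  positivity
                · simp [hk])
          exact ⟨y, hy0, hy1, mem_closure_range_of_update hne.symm hy2⟩
        · refine ⟨Function.update x i₀ 0, fun k => ?_, ⟨i₀, by simp⟩,
            mem_closure_range_of_update (i := i₀) (j := j) hne fun k => ?_⟩
          · by_cases hk : k = i₀
            · subst hk; simp
            · simpa [hk] using (hx k).le
          · rw [heq, sub_self]
            exact AddSubmonoid.subset_closure ⟨k, rfl⟩
        -- Rewrite the two terms as `c i₀ (x i₀ - x j) + (c j + c i₀) x j`. The coefficient at `j`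
        -- now lies in `[0, M]`: one negative coefficient fewer, and no new extremal index.
        · obtain ⟨y, hy0, hy1, hy2⟩ := ihn (Function.update x i₀ (x i₀ - x j))
            (Function.update c j (c j + c i₀))
            (fun k => by
              by_cases hk : k = i₀
              · subst hk; simpa using hgt
              · simpa [hk] using hx k)
            (by simp [hne, h0])
            (fun k => by
              by_cases hk : k = j
              · subst hk
                rw [Function.update_self, abs_le]
                omega
              · simpa [hk] using hM k)
            ((sum_update_smul_update c x hne).trans hrel)
            (by
              refine le_trans (Finset.card_le_card fun k => ?_) hcnt
              simp only [Finset.mem_filter, Finset.mem_univ, true_and]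
              by_cases hk : k = j
              · subst hk
                rw [Function.update_self, abs_of_nonneg (by omega)]
                intro _
                omega
              · simp [hk])
            (by
              refine Nat.lt_succ_iff.1 (lt_of_lt_of_le (Finset.card_lt_card ?_) hneg)
              rw [Finset.ssubset_iff_of_subset]
              · refine ⟨j, by simpa using hj, ?_⟩
                simp only [Finset.mem_filter, Finset.mem_univ, true_and, Function.update_self]
                omega
              · intro k
                simp only [Finset.mem_filter, Finset.mem_univ, true_and]
                by_cases hk : k = j
                · subst hk
                  intro _
                  exact hj
                · simp [hk])
          exact ⟨y, hy0, hy1, mem_closure_range_of_update hne hy2⟩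

theorem exists_nonneg_zero_of_relation {ι : Type*} [Fintype ι] {x : ι → Φ} {c : ι → ℤ}
    (hx : ∀ i, 0 < x i) (hc : c ≠ 0) (h : ∑ i, c i • x i = 0) :
    ∃ y : ι → Φ, (∀ i, 0 ≤ y i) ∧ (∃ i, y i = 0) ∧
      ∀ i, x i ∈ AddSubmonoid.closure (Set.range y) := by
  refine exists_nonneg_zero_of_relation_bounded (∑ i, (c i).natAbs) x c hx hc (fun i => ?_) h
  rw [Int.abs_eq_natAbs]
  exact_mod_cast Finset.single_le_sum (f := fun i => (c i).natAbs) (fun _ _ => Nat.zero_le _)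
    (Finset.mem_univ i)

/-- Finitely many nonnegative elements of a totally ordered abelian group are combinations with
natural coefficients of finitely many linearly independent positive elements. -/
theorem exists_linearIndependent_pos (n : ℕ) : ∀ x : Fin n → Φ, (∀ i, 0 ≤ x i) →
    ∃ (k : ℕ) (y : Fin k → Φ), (∀ i, 0 < y i) ∧ LinearIndependent ℤ y ∧
      ∀ i, x i ∈ AddSubmonoid.closure (Set.range y) := by
  induction n with
  | zero => exact fun _ _ => ⟨0, Fin.elim0, fun i => i.elim0, linearIndependent_empty_type,
      fun i => i.elim0⟩
  | succ n ih =>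
    have hzero : ∀ x : Fin (n + 1) → Φ, (∀ i, 0 ≤ x i) → (∃ i, x i = 0) →
        ∃ (k : ℕ) (y : Fin k → Φ), (∀ i, 0 < y i) ∧ LinearIndependent ℤ y ∧
          ∀ i, x i ∈ AddSubmonoid.closure (Set.range y) := by
      rintro x hx ⟨i, hi⟩
      obtain ⟨k, y, hy, hli, hmem⟩ := ih (fun j => x (i.succAbove j)) fun j => hx _
      refine ⟨k, y, hy, hli, fun j => ?_⟩
      rcases Fin.eq_self_or_eq_succAbove i j with rfl | ⟨j, rfl⟩
      · rw [hi]
        exact zero_mem _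
      · exact hmem j
    intro x hx
    by_cases h0 : ∃ i, x i = 0
    · exact hzero x hx h0
    have hpos : ∀ i, 0 < x i := fun i => (hx i).lt_of_ne fun h => h0 ⟨i, h.symm⟩
    by_cases hli : LinearIndependent ℤ x
    · exact ⟨_, x, hpos, hli, fun i => AddSubmonoid.subset_closure ⟨i, rfl⟩⟩
    -- A relation creates a zero entry without changing the number of elements; dropping that entry
    -- lets the induction on `n` proceed.
    · obtain ⟨c, hc, i, hi⟩ := Fintype.not_linearIndependent_iff.1 hli
      obtain ⟨y, hy, hy0, hxy⟩ :=
        exists_nonneg_zero_of_relation hpos (fun h => hi (congrFun h i)) hc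
      obtain ⟨k, z, hz, hzli, hyz⟩ := hzero y hy hy0
      refine ⟨k, z, hz, hzli, fun j => ?_⟩
      refine (AddSubmonoid.closure_le.2 ?_) (hxy j)
      rintro _ ⟨l, rfl⟩
      exact hyz l

end OrderedGroups

end Order

/-! ### Rational rank and nested families of free submonoids. -/

section Families

section RationalRank

theorem rank_eq_rationalRank {Φ : Type*} [AddCommGroup Φ] (h : FiniteRationalRank Φ) :
    Module.rank ℤ Φ = rationalRank Φ := by
  have : Module.Finite ℚ (ℚ ⊗[ℤ] Φ) := h
  have h1 := (TensorProduct.isBaseChange ℤ Φ ℚ).lift_rank_eq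
  rw [rationalRank, ← Cardinal.lift_inj.{_, 0}]
  rw [← Module.finrank_eq_rank ℚ (ℚ ⊗[ℤ] Φ)] at h1
  simpa using h1.symm

variable {Φ : Type*} [AddCommGroup Φ]

theorem exists_linearIndependent_fin_rationalRank (h : FiniteRationalRank Φ) :
    ∃ x : Fin (rationalRank Φ) → Φ, LinearIndependent ℤ x := by
  obtain ⟨s, hs, hli⟩ := exists_finset_linearIndependent_of_le_rank
    (R := ℤ) (M := Φ) (n := rationalRank Φ) (rank_eq_rationalRank h).ge
  exact ⟨fun i => (s.equivFinOfCardEq hs).symm i,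
    LinearIndependent.comp hli _ (s.equivFinOfCardEq hs).symm.injective⟩

theorem card_le_rationalRank (h : FiniteRationalRank Φ) {k : ℕ} {y : Fin k → Φ}
    (hy : LinearIndependent ℤ y) : k ≤ rationalRank Φ := by
  have h1 := hy.cardinal_lift_le_rank
  rw [rank_eq_rationalRank h] at h1
  simpa using h1

/-- An ordered group is torsion-free, hence flat over `ℤ`, so it embeds in `ℚ ⊗ Φ`, which is
countable in finite dimension. -/
theorem countable_of_finiteRationalRank [LinearOrder Φ] [IsOrderedAddMonoid Φ]
    (h : FiniteRationalRank Φ) : Countable Φ := by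
  have : Module.Finite ℚ (ℚ ⊗[ℤ] Φ) := h
  have hinj : Function.Injective fun φ : Φ => (1 : ℚ) ⊗ₜ[ℤ] φ := by
    have := Module.Flat.rTensor_preserves_injective_linearMap (M := Φ)
      (Algebra.linearMap ℤ ℚ) (RingHom.injective_int (algebraMap ℤ ℚ))
    intro a b hab
    have h2 : (1 : ℤ) ⊗ₜ[ℤ] a = (1 : ℤ) ⊗ₜ[ℤ] b := this (by simpa using hab)
    simpa using congrArg (TensorProduct.lid ℤ Φ) h2
  have : Countable (ℚ ⊗[ℤ] Φ) :=
    (Module.finBasis ℚ (ℚ ⊗[ℤ] Φ)).equivFun.toEquiv.countable_iff.2 inferInstance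
  exact hinj.countable

end RationalRank

variable {Φ : Type*} [AddCommGroup Φ]

/-- The degree determines the exponents: this gives irreducibility of the generators and algebraic
independence of the variables. -/
theorem linearIndependent_int_injective {ι : Type*} [Fintype ι] {y : ι → Φ}
    (hy : LinearIndependent ℤ y) : Function.Injective fun m : ι → ℕ => ∑ i, m i • y i := by
  intro f g hfg
  have h1 : ∑ i, ((f i : ℤ) - g i) • y i = 0 := by
    simp only [sub_smul, Finset.sum_sub_distrib, natCast_zsmul]
    exact sub_eq_zero.2 hfg
  funext i
  have := Fintype.linearIndependent_iff.1 hy _ h1 i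
  omega

variable [LinearOrder Φ]

variable (Φ) in
/-- Finitely many linearly independent positive elements of `Φ`, as many as the rational rank of
`Φ` if it is finite; they freely generate a submonoid of `Φ₊ ∪ {0}`. -/
structure PosFamily where
  /-- the number of elements -/
  n : ℕ
  /-- the elements -/
  e : Fin n → Φ
  pos : ∀ i, 0 < e i
  indep : LinearIndependent ℤ e
  card_eq : FiniteRationalRank Φ → n = rationalRank Φ

/-- The submonoid generated by a family. -/
def PosFamily.monoid (P : PosFamily Φ) : AddSubmonoid Φ :=
  AddSubmonoid.closure (Set.range P.e)

theorem PosFamily.e_mem (P : PosFamily Φ) (i : Fin P.n) : P.e i ∈ P.monoid :=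
  AddSubmonoid.subset_closure ⟨i, rfl⟩

theorem PosFamily.monoid_le {P : PosFamily Φ} {N : AddSubmonoid Φ} (h : ∀ i, P.e i ∈ N) :
    P.monoid ≤ N := by
  refine AddSubmonoid.closure_le.2 ?_
  rintro _ ⟨i, rfl⟩
  exact h i

theorem PosFamily.mem_monoid_iff (P : PosFamily Φ) {φ : Φ} :
    φ ∈ P.monoid ↔ ∃ m : Fin P.n → ℕ, φ = ∑ i, m i • P.e i :=
  AddSubmonoid.mem_closure_range_iff_of_fintype

/-- The members of a family are irreducible in the submonoid that it generates. -/
theorem PosFamily.ne_add (P : PosFamily Φ) (i : Fin P.n) {a b : Φ}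
    (ha : a ∈ P.monoid) (hb : b ∈ P.monoid) (ha0 : a ≠ 0) (hb0 : b ≠ 0) : P.e i ≠ a + b := by
  intro h
  obtain ⟨m, rfl⟩ := P.mem_monoid_iff.1 ha
  obtain ⟨l, rfl⟩ := P.mem_monoid_iff.1 hb
  -- A unit vector is not a sum of two nonzero vectors of natural numbers.
  have h2 : (Pi.single i 1 : Fin P.n → ℕ) = m + l := by
    apply linearIndependent_int_injective P.indep
    simp only [Pi.add_apply, add_smul, Finset.sum_add_distrib, ← h]
    simp [Pi.single_apply]
  have h3 : ∀ j, j ≠ i → m j = 0 ∧ l j = 0 := fun j hj => by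
    have := congrFun h2 j
    simp only [Pi.single_apply, hj, if_false, Pi.add_apply] at this
    omega
  have h4 : m i + l i = 1 := by simpa using (congrFun h2 i).symm
  rcases Nat.eq_zero_or_pos (m i) with h5 | h5
  · refine ha0 (Finset.sum_eq_zero fun j _ => ?_)
    by_cases hj : j = i
    · subst hj; rw [h5, zero_smul]
    · rw [(h3 j hj).1, zero_smul]
  · refine hb0 (Finset.sum_eq_zero fun j _ => ?_)
    by_cases hj : j = i
    · subst hj; rw [show l j = 0 by omega, zero_smul]
    · rw [(h3 j hj).2, zero_smul]

/-- An element of the submonoid generated by a family is zero, a member or decomposable. -/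
theorem PosFamily.exists_add (P : PosFamily Φ)
    {φ : Φ} (h : φ ∈ P.monoid) (h0 : φ ≠ 0) (he : ∀ i, P.e i ≠ φ) :
    ∃ a ∈ P.monoid, ∃ b ∈ P.monoid, a ≠ 0 ∧ b ≠ 0 ∧ φ = a + b := by
  have key : φ = 0 ∨ (∃ i, P.e i = φ) ∨
      ∃ a ∈ P.monoid, ∃ b ∈ P.monoid, a ≠ 0 ∧ b ≠ 0 ∧ φ = a + b := by
    refine AddSubmonoid.closure_induction (motive := fun φ _ => φ = 0 ∨ (∃ i, P.e i = φ) ∨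
      ∃ a ∈ P.monoid, ∃ b ∈ P.monoid, a ≠ 0 ∧ b ≠ 0 ∧ φ = a + b) ?_ ?_ ?_ h
    · rintro _ ⟨i, rfl⟩
      exact Or.inr (Or.inl ⟨i, rfl⟩)
    · exact Or.inl rfl
    · intro a b ha hb iha ihb
      by_cases ha0 : a = 0
      · subst ha0
        simpa using ihb
      by_cases hb0 : b = 0
      · subst hb0
        simpa using iha
      exact Or.inr (Or.inr ⟨a, ha, b, hb, ha0, hb0, rfl⟩)
  rcases key with h | ⟨i, hi⟩ | h
  · exact absurd h h0
  · exact absurd hi (he i)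
  · exact h

theorem PosFamily.exists_monoid_of_finset {c : ℕ → PosFamily Φ} (hc : Monotone fun h => (c h).monoid)
    (hc' : ∀ φ : Φ, 0 ≤ φ → ∃ h, φ ∈ (c h).monoid) (s : Finset (NonnegPart Φ)) :
    ∃ h, ∀ φ ∈ s, (φ : Φ) ∈ (c h).monoid := by
  choose f hf using fun φ : NonnegPart Φ => hc' φ φ.2
  exact ⟨s.sup f, fun φ hφ => hc (Finset.le_sup hφ) (hf φ)⟩

variable [IsOrderedAddMonoid Φ]

/-- Any family whose monoid contains `G` has at least `r(Φ)` members when the rank is finite. -/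
theorem exists_finite_linearIndependent_nonneg :
    ∃ G : Set Φ, G.Finite ∧ (∀ φ ∈ G, 0 ≤ φ) ∧ (FiniteRationalRank Φ →
      ∃ z : Fin (rationalRank Φ) → Φ, LinearIndependent ℤ z ∧ Set.range z ⊆ G) := by
  by_cases h : FiniteRationalRank Φ
  · obtain ⟨z, hz⟩ := exists_linearIndependent_fin_rationalRank h
    refine ⟨Set.range fun i => |z i|, Set.finite_range _,
      by rintro _ ⟨i, rfl⟩; exact abs_nonneg _, fun _ => ⟨_, ?_, subset_rfl⟩⟩
    -- Passing to absolute values multiplies each vector by `±1`, which preserves independence.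
    have h1 := hz.units_smul fun i => if 0 ≤ z i then (1 : ℤˣ) else -1
    convert h1 using 1
    funext i
    by_cases h0 : 0 ≤ z i
    · simp [h0, abs_of_nonneg]
    · simp [h0, abs_of_nonpos (not_le.1 h0).le]
  · exact ⟨∅, Set.finite_empty, by simp, fun h' => absurd h' h⟩

/-- Finitely many nonnegative elements lie in the submonoid generated by a family of linearly
independent positive elements. -/
theorem exists_posFamily {F : Set Φ} (hF : F.Finite) (hF0 : ∀ φ ∈ F, 0 ≤ φ) :
    ∃ P : PosFamily Φ, F ⊆ P.monoid := by
  obtain ⟨G, hG, hG0, hGz⟩ := exists_finite_linearIndependent_nonneg (Φ := Φ)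
  obtain ⟨n, x, hx⟩ := (hF.union hG).fin_embedding
  have hx' : ∀ i, x i ∈ F ∪ G := fun i => hx ▸ Set.mem_range_self i
  obtain ⟨k, y, hy, hli, hmem⟩ := exists_linearIndependent_pos n x
    fun i => (hx' i).elim (hF0 _) (hG0 _)
  have hall : ∀ φ ∈ F ∪ G, φ ∈ AddSubmonoid.closure (Set.range y) := by
    intro φ hφ
    rw [← hx] at hφ
    obtain ⟨i, rfl⟩ := hφ
    exact hmem i
  refine ⟨⟨k, y, hy, hli, fun h => le_antisymm (card_le_rationalRank h hli) ?_⟩,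
    fun φ hφ => hall φ (Or.inl hφ)⟩
  obtain ⟨z, hz, hzG⟩ := hGz h
  have h1 := linearIndependent_le_span_aux' z hz (Set.range y) fun φ hφ => by
    have h2 : AddSubmonoid.closure (Set.range y) ≤
        (Submodule.span ℤ (Set.range y)).toAddSubmonoid :=
      AddSubmonoid.closure_le.2 Submodule.subset_span
    exact h2 (hall φ (Or.inr (hzG hφ)))
  rw [Fintype.card_fin] at h1
  exact h1.trans ((Fintype.card_range_le y).trans_eq (Fintype.card_fin k))

theorem exists_posFamily_ge (P : PosFamily Φ) {F : Set Φ} (hF : F.Finite)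
    (hF0 : ∀ φ ∈ F, 0 ≤ φ) : ∃ Q : PosFamily Φ, P.monoid ≤ Q.monoid ∧ F ⊆ Q.monoid := by
  obtain ⟨Q, hQ⟩ := exists_posFamily (F := F ∪ Set.range P.e) (hF.union (Set.finite_range _))
    (by
      rintro φ (hφ | ⟨i, rfl⟩)
      exacts [hF0 _ hφ, (P.pos i).le])
  exact ⟨Q, P.monoid_le fun i => hQ (Or.inr ⟨i, rfl⟩), fun φ hφ => hQ (Or.inl hφ)⟩

/-- If `Φ` is countable, the semigroup `Φ₊ ∪ {0}` is the union of a nested sequence of finitely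
generated free submonoids. -/
theorem exists_monotone_posFamily [Countable Φ] :
    ∃ c : ℕ → PosFamily Φ, Monotone (fun h => (c h).monoid) ∧
      ∀ φ : Φ, 0 ≤ φ → ∃ h, φ ∈ (c h).monoid := by
  obtain ⟨f, hf⟩ := exists_surjective_nat Φ
  obtain ⟨P₀, -⟩ := exists_posFamily (F := (∅ : Set Φ)) Set.finite_empty (by simp)
  choose g hg1 hg2 using fun (P : PosFamily Φ) (φ : Φ) =>
    exists_posFamily_ge P (F := {|φ|}) (Set.finite_singleton _) (by simp)
  -- Stage `h + 1` absorbs `|f h|`, so that every nonnegative element is eventually reached.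
  let c : ℕ → PosFamily Φ := fun h => Nat.rec P₀ (fun h P => g P (f h)) h
  refine ⟨c, monotone_nat_of_le_succ fun h => hg1 (c h) (f h), fun φ hφ => ?_⟩
  obtain ⟨h, rfl⟩ := hf φ
  refine ⟨h + 1, ?_⟩
  have := hg2 (c h) (f h) rfl
  rwa [abs_of_nonneg hφ] at this

end Families

/-! ### Bases multiplicative up to units, and their polynomial subalgebras. -/

section TermBases

variable {Φ : Type*} [AddCommGroup Φ] [LinearOrder Φ] [IsOrderedAddMonoid Φ]
variable {A B : Type*} [CommRing A] [CommRing B] [Algebra A B]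

theorem finsupp_sum_nsmul {ι M : Type*} [Fintype ι] [AddCommMonoid M] (d : ι → M) (m : ι →₀ ℕ) :
    (m.sum fun i k => k • d i) = ∑ i, m i • d i :=
  Finsupp.sum_fintype _ _ fun i => zero_smul ℕ (d i)

/-- An `A`-basis of `B` consisting of one homogeneous element of each degree in `Φ₊ ∪ {0}`, which
is multiplicative up to constants in a group `C` of units of `A`. -/
structure TermBasis (A : Type*) {B : Type*} [CommRing A] [CommRing B] [Algebra A B]
    (comp : NonnegPart Φ → AddSubgroup B) (C : Subgroup Aˣ) where
  /-- the basis -/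
  u : Module.Basis (NonnegPart Φ) A B
  mem : ∀ φ, u φ ∈ comp φ
  one : ∃ c ∈ C, u 0 = (c : A) • (1 : B)
  mul : ∀ φ ψ, ∃ c ∈ C, u (φ + ψ) = (c : A) • (u φ * u ψ)

variable {comp : NonnegPart Φ → AddSubgroup B} {C : Subgroup Aˣ}

namespace TermBasis

variable (T : TermBasis A comp C)

theorem u_eq_smul_prod {ι : Type*} (d : ι → NonnegPart Φ) (m : ι →₀ ℕ) :
    ∀ φ : NonnegPart Φ, (φ : Φ) = m.sum (fun i k => k • (d i : Φ)) →
      ∃ c ∈ C, T.u φ = (c : A) • m.prod fun i k => T.u (d i) ^ k := by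
  classical
  induction m using Finsupp.induction_linear with
  | zero =>
    intro φ hφ
    obtain rfl : φ = 0 := Subtype.ext (by simpa using hφ)
    simpa using T.one
  | add f g hf hg =>
    intro φ hφ
    have hnn : ∀ m : ι →₀ ℕ, 0 ≤ m.sum fun i k => k • (d i : Φ) := fun m =>
      Finset.sum_nonneg fun i _ => nsmul_nonneg (d i).2 _
    obtain ⟨c₁, hc₁, h₁⟩ := hf ⟨_, hnn f⟩ rfl
    obtain ⟨c₂, hc₂, h₂⟩ := hg ⟨_, hnn g⟩ rfl
    obtain ⟨c₃, hc₃, h₃⟩ := T.mul ⟨_, hnn f⟩ ⟨_, hnn g⟩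
    have hφ' : φ = ⟨_, hnn f⟩ + ⟨_, hnn g⟩ := by
      refine Subtype.ext (hφ.trans ?_)
      rw [Finsupp.sum_add_index' (by simp) (by intros; rw [add_smul])]
      rfl
    refine ⟨c₃ * (c₁ * c₂), mul_mem hc₃ (mul_mem hc₁ hc₂), ?_⟩
    rw [hφ', h₃, h₁, h₂, Finsupp.prod_add_index' (by simp) (by intros; rw [pow_add]),
      smul_mul_smul_comm, smul_smul]
    push_cast
    rfl
  | single i k =>
    rw [Finsupp.sum_single_index (by simp), Finsupp.prod_single_index (by simp)]
    induction k with
    | zero =>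
      intro φ hφ
      obtain rfl : φ = 0 := Subtype.ext (by simpa using hφ)
      simpa using T.one
    | succ k ih =>
      intro φ hφ
      obtain ⟨c₁, hc₁, h₁⟩ := ih ⟨k • (d i : Φ), nsmul_nonneg (d i).2 _⟩ rfl
      obtain ⟨c₃, hc₃, h₃⟩ := T.mul ⟨k • (d i : Φ), nsmul_nonneg (d i).2 _⟩ (d i)
      have hφ' : φ = ⟨k • (d i : Φ), nsmul_nonneg (d i).2 _⟩ + d i :=
        Subtype.ext (hφ.trans (succ_nsmul _ _))
      refine ⟨c₃ * c₁, mul_mem hc₃ hc₁, ?_⟩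
      rw [hφ', h₃, h₁, pow_succ, smul_mul_assoc, smul_smul]
      push_cast
      rfl

/-- Distinct exponents have distinct degrees, so the monomials are, up to units, distinct members of
the basis. -/
theorem algebraicIndependent {ι : Type*} [Fintype ι] {d : ι → NonnegPart Φ}
    (hd : LinearIndependent ℤ fun i => (d i : Φ)) :
    AlgebraicIndependent A fun i => T.u (d i) := by
  have hnn : ∀ m : ι →₀ ℕ, 0 ≤ m.sum fun i k => k • (d i : Φ) := fun m =>
    Finset.sum_nonneg fun i _ => nsmul_nonneg (d i).2 _
  choose c _ hc using fun m => T.u_eq_smul_prod d m ⟨_, hnn m⟩ rfl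
  have hinj : Function.Injective fun m : ι →₀ ℕ => (⟨_, hnn m⟩ : NonnegPart Φ) := by
    intro f g hfg
    have h1 := congrArg Subtype.val hfg
    simp only [finsupp_sum_nsmul] at h1
    exact DFunLike.coe_injective (linearIndependent_int_injective hd h1)
  have hli : LinearIndependent A fun m : ι →₀ ℕ => m.prod fun i k => T.u (d i) ^ k := by
    have h1 := (T.u.linearIndependent.comp _ hinj).units_smul fun m => (c m)⁻¹
    convert h1 using 1
    funext m
    simp only [Pi.smul_apply', Function.comp_apply, hc m, Units.smul_def, smul_smul]
    simp
  rw [algebraicIndependent_iff_injective_aeval]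
  refine (injective_iff_map_eq_zero
    (MvPolynomial.aeval fun i => T.u (d i) : MvPolynomial ι A →ₐ[A] B)).2 fun p hp => ?_
  rw [MvPolynomial.aeval_def, MvPolynomial.eval₂_eq'] at hp
  ext m
  by_cases hm : m ∈ p.support
  · refine linearIndependent_iff'.1 hli p.support (fun m => p.coeff m) ?_ m hm
    rw [← hp]
    exact Finset.sum_congr rfl fun m _ => by
      rw [Algebra.smul_def, Finsupp.prod_fintype _ _ fun i => pow_zero (T.u (d i))]
  · simpa using hm

/-- The graded polynomial subalgebra generated by the basis elements whose degrees are in a family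
of linearly independent positive elements. -/
def toGradedPoly (P : PosFamily Φ) : GradedPolySubalgebra A comp where
  n := P.n
  x i := T.u ⟨P.e i, (P.pos i).le⟩
  deg i := ⟨P.e i, (P.pos i).le⟩
  deg_pos := P.pos
  x_mem _ := T.mem _
  algInd := T.algebraicIndependent P.indep

variable {P Q : PosFamily Φ}

theorem u_eq_smul_prod_of_mem {φ : NonnegPart Φ} (h : (φ : Φ) ∈ P.monoid) :
    ∃ c ∈ C, ∃ m : Fin P.n → ℕ, T.u φ = (c : A) • ∏ i, (T.toGradedPoly P).x i ^ m i := by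
  obtain ⟨m, hm⟩ := P.mem_monoid_iff.1 h
  obtain ⟨c, hc, h⟩ := T.u_eq_smul_prod (fun i => ⟨P.e i, (P.pos i).le⟩)
    (Finsupp.equivFunOnFinite.symm m) φ (by
      rw [hm]
      exact (finsupp_sum_nsmul P.e (Finsupp.equivFunOnFinite.symm m)).symm)
  refine ⟨c, hc, m, h.trans ?_⟩
  rw [Finsupp.prod_fintype _ _ fun i => pow_zero _]
  rfl

theorem u_mem_toSubalgebra {φ : NonnegPart Φ} (h : (φ : Φ) ∈ P.monoid) :
    T.u φ ∈ (T.toGradedPoly P).toSubalgebra := by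
  obtain ⟨c, -, m, h⟩ := T.u_eq_smul_prod_of_mem h
  rw [h]
  exact Subalgebra.smul_mem _ (Subalgebra.prod_mem _ fun i _ =>
    Subalgebra.pow_mem _ (Algebra.subset_adjoin (Set.mem_range_self i)) _) _

theorem mem_toSubalgebra {b : B} (h : ∀ φ ∈ (T.u.repr b).support, (φ : Φ) ∈ P.monoid) :
    b ∈ (T.toGradedPoly P).toSubalgebra := by
  rw [← T.u.linearCombination_repr b, Finsupp.linearCombination_apply, Finsupp.sum]
  exact sum_mem fun φ hφ => Subalgebra.smul_mem _ (T.u_mem_toSubalgebra (h φ hφ)) _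

theorem toSubalgebra_le (h : P.monoid ≤ Q.monoid) :
    (T.toGradedPoly P).toSubalgebra ≤ (T.toGradedPoly Q).toSubalgebra := by
  refine Algebra.adjoin_le ?_
  rintro _ ⟨i, rfl⟩
  exact T.u_mem_toSubalgebra (h (P.e_mem i))

/-- Converse of `toSubalgebra_le` at the level of degrees; it makes every inclusion of subalgebras
toric. The subalgebra is spanned by monomials, which are up to units the basis elements with degree
in `P.monoid`, and no other basis element lies in their span. -/
theorem mem_monoid_of_u_mem [Nontrivial A] {φ : NonnegPart Φ}
    (h : T.u φ ∈ (T.toGradedPoly P).toSubalgebra) : (φ : Φ) ∈ P.monoid := by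
  let N : Submonoid B :=
    { carrier := {b | ∃ ψ : NonnegPart Φ, (ψ : Φ) ∈ P.monoid ∧ ∃ c ∈ C, T.u ψ = (c : A) • b}
      one_mem' := ⟨0, zero_mem _, T.one⟩
      mul_mem' := by
        rintro a b ⟨ψ, hψ, c, hc, h⟩ ⟨ψ', hψ', c', hc', h'⟩
        obtain ⟨c₃, hc₃, h₃⟩ := T.mul ψ ψ'
        refine ⟨ψ + ψ', add_mem hψ hψ', c₃ * (c * c'), mul_mem hc₃ (mul_mem hc hc'), ?_⟩
        rw [h₃, h, h', smul_mul_smul_comm, smul_smul]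
        push_cast
        rfl }
  have h1 : Submonoid.closure (Set.range (T.toGradedPoly P).x) ≤ N := by
    refine Submonoid.closure_le.2 ?_
    rintro _ ⟨i, rfl⟩
    exact ⟨⟨P.e i, (P.pos i).le⟩, P.e_mem i, 1, one_mem _, by simp [toGradedPoly]⟩
  have h2 : T.u φ ∈ Submodule.span A (T.u '' {ψ | (ψ : Φ) ∈ P.monoid}) := by
    have h3 : T.u φ ∈ Subalgebra.toSubmodule (Algebra.adjoin A (Set.range (T.toGradedPoly P).x)) :=
      h
    rw [Algebra.adjoin_eq_span] at h3
    refine Submodule.span_le.2 ?_ h3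
    intro b hb
    obtain ⟨ψ, hψ, c, -, h⟩ := h1 hb
    have h4 : b = ((c⁻¹ : Aˣ) : A) • T.u ψ := by
      rw [h, smul_smul]
      simp
    rw [h4]
    exact Submodule.smul_mem _ _ (Submodule.subset_span ⟨ψ, hψ, rfl⟩)
  by_contra hφ
  exact T.u.linearIndependent.notMem_span_image (s := {ψ | (ψ : Φ) ∈ P.monoid}) hφ h2

theorem termInclusion (h : P.monoid ≤ Q.monoid) :
    TermInclusion (T.toGradedPoly P) (T.toGradedPoly Q) := by
  refine ⟨T.toSubalgebra_le h, fun i => ?_⟩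
  obtain ⟨c, -, m, hm⟩ := T.u_eq_smul_prod_of_mem
    (φ := ⟨P.e i, (P.pos i).le⟩) (h (P.e_mem i))
  exact ⟨c, m, hm⟩

theorem toricInclusion (T : TermBasis A comp ⊥) (h : P.monoid ≤ Q.monoid) :
    ToricInclusion (T.toGradedPoly P) (T.toGradedPoly Q) := by
  refine ⟨T.toSubalgebra_le h, fun i => ?_⟩
  obtain ⟨c, hc, m, hm⟩ := T.u_eq_smul_prod_of_mem
    (φ := ⟨P.e i, (P.pos i).le⟩) (h (P.e_mem i))
  rw [Subgroup.mem_bot.1 hc, Units.val_one, one_smul] at hm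
  exact ⟨m, hm⟩

theorem toricInclusion_of_le (T : TermBasis A comp ⊥)
    (h : (T.toGradedPoly P).toSubalgebra ≤ (T.toGradedPoly Q).toSubalgebra) :
    ToricInclusion (T.toGradedPoly P) (T.toGradedPoly Q) := by
  -- Over the zero ring degrees carry no information, but then `B` is zero and any exponents do.
  rcases subsingleton_or_nontrivial A with hA | hA
  · have := Module.subsingleton A B
    exact ⟨h, fun i => ⟨0, Subsingleton.elim _ _⟩⟩
  · refine T.toricInclusion (PosFamily.monoid_le fun i => ?_)
    exact T.mem_monoid_of_u_mem (φ := ⟨P.e i, (P.pos i).le⟩)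
      (h (T.u_mem_toSubalgebra (P.e_mem i)))

theorem isToricDirectLimit (T : TermBasis A comp ⊥) :
    IsToricDirectLimit (Set.range T.toGradedPoly) where
  nonempty := by
    obtain ⟨P, -⟩ := exists_posFamily (F := (∅ : Set Φ)) Set.finite_empty (by simp)
    exact ⟨_, P, rfl⟩
  directed := by
    rintro _ ⟨P, rfl⟩ _ ⟨Q, rfl⟩
    obtain ⟨R, hR, hR'⟩ := exists_posFamily_ge P (Set.finite_range Q.e) (by
      rintro _ ⟨i, rfl⟩
      exact (Q.pos i).le)
    exact ⟨_, ⟨R, rfl⟩, T.toSubalgebra_le hR,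
      T.toSubalgebra_le (PosFamily.monoid_le fun i => hR' ⟨i, rfl⟩)⟩
  toric := by
    rintro _ ⟨P, rfl⟩ _ ⟨Q, rfl⟩ h
    exact T.toricInclusion_of_le h
  union b := by
    obtain ⟨P, hP⟩ := exists_posFamily
      (F := (Subtype.val : NonnegPart Φ → Φ) '' ((T.u.repr b).support : Set (NonnegPart Φ)))
      ((Finset.finite_toSet _).image _) (by
        rintro _ ⟨φ, -, rfl⟩
        exact φ.2)
    exact ⟨_, ⟨P, rfl⟩, T.mem_toSubalgebra fun φ hφ => hP ⟨φ, hφ, rfl⟩⟩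

end TermBasis

/-- The monomials `t^φ` in the algebra `A[t^{Φ₊}]`. -/
def semigroupTermBasis (A Φ : Type*) [CommRing A] [AddCommGroup Φ] [LinearOrder Φ]
    [IsOrderedAddMonoid Φ] : TermBasis A (semigroupComp A Φ) ⊥ where
  u := AddMonoidAlgebra.basis _ _
  mem φ := by
    rw [AddMonoidAlgebra.basis_apply]
    exact AddMonoidAlgebra.single_mem_grade φ (1 : A)
  one := ⟨1, one_mem _, by
    rw [AddMonoidAlgebra.basis_apply, Units.val_one, one_smul]
    rfl⟩
  mul φ ψ := ⟨1, one_mem _, by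
    simp [AddMonoidAlgebra.basis_apply, AddMonoidAlgebra.single_mul_single]⟩

theorem semigroupTermBasis_u (A : Type*) [CommRing A] (φ : NonnegPart Φ) :
    (semigroupTermBasis A Φ).u φ = AddMonoidAlgebra.single φ (1 : A) :=
  AddMonoidAlgebra.basis_apply _ _

end TermBases

/-! ### Presentation by binomials. -/

section BinomialPresentations

variable {Φ : Type*} [AddCommGroup Φ] [LinearOrder Φ] [IsOrderedAddMonoid Φ]
variable {A B : Type*} [CommRing A] [CommRing B] [Algebra A B]
variable {comp : NonnegPart Φ → AddSubgroup B} {C : Subgroup Aˣ}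

namespace TermBasis

/-- A positive element of the submonoid generated by a family which is not in the family yields
a binomial relation between the corresponding elements of a term basis. -/
theorem exists_binomial (T : TermBasis A comp C) {J : Type*} {deg : J → NonnegPart Φ}
    (hdeg : ∀ φ, 0 < φ → ∃ j, deg j = φ) (P : PosFamily Φ) {φ : NonnegPart Φ} (hφ0 : φ ≠ 0)
    (hφ : (φ : Φ) ∈ P.monoid) (he : ∀ i, P.e i ≠ φ) :
    ∃ (c : Aˣ) (m : J →₀ ℕ), 2 ≤ (m.sum fun _ e => e) ∧
      (m.sum fun i e => e • (deg i : Φ)) = φ ∧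
      T.u φ = (c : A) • (m.prod fun i e => T.u (deg i) ^ e) ∧
      ∀ j ∈ m.support, ∃ i, P.e i = deg j := by
  classical
  choose g hg using fun i => hdeg ⟨P.e i, (P.pos i).le⟩ (P.pos i)
  obtain ⟨m₀, hm₀⟩ := P.mem_monoid_iff.1 hφ
  let m : J →₀ ℕ := Finsupp.mapDomain g (Finsupp.equivFunOnFinite.symm m₀)
  have hsum : (m.sum fun i e => e • (deg i : Φ)) = φ := by
    have h1 := Finsupp.sum_mapDomain_index (f := g) (s := Finsupp.equivFunOnFinite.symm m₀)
      (h := fun j k => k • (deg j : Φ)) (fun j => zero_smul ℕ (deg j : Φ))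
      fun j k l => add_smul k l (deg j : Φ)
    simp only [hg] at h1
    rw [hm₀]
    refine h1.trans ?_
    exact finsupp_sum_nsmul P.e (Finsupp.equivFunOnFinite.symm m₀)
  have hsupp : ∀ j ∈ m.support, ∃ i, P.e i = deg j := by
    intro j hj
    obtain ⟨i, -, rfl⟩ := Finset.mem_image.1 (Finsupp.mapDomain_support hj)
    exact ⟨i, by rw [hg]⟩
  obtain ⟨c, -, hc⟩ := T.u_eq_smul_prod deg m φ hsum.symm
  refine ⟨c, m, ?_, hsum, hc, hsupp⟩
  -- Total exponent `0` would give `φ = 0`, and total exponent `1` would make `φ` a member of the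
  -- family.
  by_contra! hlt
  interval_cases h : m.sum fun _ e => e
  · have hm : m = 0 := by
      ext j
      by_contra hj
      have := (Finset.sum_eq_zero_iff (s := m.support) (f := fun j => m j)).1 h j
        (Finsupp.mem_support_iff.2 hj)
      exact hj this
    rw [hm, Finsupp.sum_zero_index] at hsum
    exact hφ0 (Subtype.ext hsum.symm)
  · obtain ⟨j, hj⟩ := (Finsupp.sum_eq_one_iff m).1 h
    obtain ⟨i, hi⟩ := hsupp j (by simp [hj])
    rw [hj, Finsupp.sum_single_index (zero_smul ℕ (deg j : Φ)), one_smul] at hsum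
    exact he i (hi.trans hsum)

theorem hasBinomialPresentation [Countable Φ] (T : TermBasis A comp C) :
    HasBinomialPresentation A comp := by
  classical
  obtain ⟨c, hmono, hcov⟩ := exists_monotone_posFamily (Φ := Φ)
  obtain ⟨f, hf⟩ := Countable.exists_injective_nat {φ : NonnegPart Φ // 0 < φ}
  -- The positive degrees are indexed by a set of natural numbers, since `J` must live in `Type`
  -- whatever the universe of `Φ`.
  let J : Type := Set.range f
  let deg : J → NonnegPart Φ := fun j => ((Equiv.ofInjective f hf).symm j).1
  have hpos : ∀ j, 0 < deg j := fun j => ((Equiv.ofInjective f hf).symm j).2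
  have hinj : Function.Injective deg :=
    Subtype.val_injective.comp (Equiv.ofInjective f hf).symm.injective
  have hdeg : ∀ φ, 0 < φ → ∃ j, deg j = φ := fun φ hφ =>
    ⟨Equiv.ofInjective f hf ⟨φ, hφ⟩, by simp [deg]⟩
  let D : J → ℕ → Prop := fun j h => (deg j : Φ) ∈ (c h).monoid ∧ ∀ i, (c h).e i ≠ deg j
  let J' : Set J := {j | ∃ h, D j h}
  have hrel : ∀ j, ∃ (k : Aˣ) (m : J →₀ ℕ), j ∈ J' → ∃ h, D j h ∧ (∀ h', D j h' → h ≤ h') ∧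
      2 ≤ (m.sum fun _ e => e) ∧ (m.sum fun i e => e • (deg i : Φ)) = deg j ∧
      T.u (deg j) = (k : A) • (m.prod fun i e => T.u (deg i) ^ e) ∧
      ∀ j' ∈ m.support, ∃ i, (c h).e i = deg j' := by
    intro j
    by_cases hj : j ∈ J'
    -- The binomial is written at the first stage where the degree lies in the monoid without being
    -- a generator; minimality is what makes the stages nested below.
    · have hD := Nat.find_spec hj
      obtain ⟨k, m, h1, h2, h3, h4⟩ :=
        T.exists_binomial hdeg (c (Nat.find hj)) (hpos j).ne' hD.1 hD.2
      exact ⟨k, m, fun _ => ⟨_, hD, fun h' => Nat.find_min' hj, h1, h2, h3, h4⟩⟩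
    · exact ⟨1, 0, fun h => absurd h hj⟩
  choose lam m hrel using hrel
  let π : MvPolynomial J A →ₐ[A] B := MvPolynomial.aeval fun j => T.u (deg j)
  let I : Ideal (MvPolynomial J A) := Ideal.span
    {f | ∃ j ∈ J', f = MvPolynomial.X j - MvPolynomial.monomial (m j) (lam j : A)}
  have hIπ : I ≤ RingHom.ker π := by
    refine Ideal.span_le.2 ?_
    rintro _ ⟨j, hj, rfl⟩
    obtain ⟨h, -, -, -, -, h3, -⟩ := hrel j hj
    simp [π, MvPolynomial.aeval_monomial, h3, Algebra.smul_def]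
  refine ⟨J, inferInstance, deg, π, J', lam, m, hpos, fun j => ?_, ?_, fun j hj => ?_,
    fun j hj => ?_, le_antisymm (fun p hp => ?_) hIπ⟩
  · simpa [π] using T.mem (deg j)
  · rw [← AlgHom.range_eq_top, eq_top_iff, ← Subalgebra.toSubmodule.le_iff_le,
      Algebra.top_toSubmodule, ← T.u.span_eq]
    refine Submodule.span_le.2 ?_
    rintro _ ⟨φ, rfl⟩
    rcases eq_or_lt_of_le (show 0 ≤ φ from φ.2) with h0 | h0
    · obtain ⟨k, -, hk⟩ := T.one
      rw [← h0, hk]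
      exact Subalgebra.smul_mem _ (one_mem _) _
    · obtain ⟨j, rfl⟩ := hdeg φ h0
      exact ⟨MvPolynomial.X j, by simp [π]⟩
  · obtain ⟨h, -, -, h1, -⟩ := hrel j hj
    exact h1
  · obtain ⟨h, -, -, -, h2, -⟩ := hrel j hj
    refine Subtype.ext (Eq.trans ?_ h2)
    exact map_finsuppSum (Nonneg.coeAddMonoidHom : NonnegPart Φ →+ Φ) (m j) _
  let q : MvPolynomial J A →ₐ[A] MvPolynomial J A ⧸ I := Ideal.Quotient.mkₐ A I
  choose idx hidx using fun h i => hdeg ⟨(c h).e i, ((c h).pos i).le⟩ ((c h).pos i)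
  -- `S h` is the candidate in the quotient for the polynomial subalgebra of stage `h`.
  let S : ℕ → Subalgebra A (MvPolynomial J A ⧸ I) := fun h =>
    Algebra.adjoin A (Set.range fun i => q (MvPolynomial.X (idx h i)))
  have hS : ∀ j h i, (c h).e i = deg j → q (MvPolynomial.X j) ∈ S h := by
    intro j h i hi
    have : j = idx h i := hinj (Subtype.ext ((hi.symm.trans (by rw [hidx]))))
    rw [this]
    exact Algebra.subset_adjoin ⟨i, rfl⟩
  have hS' : ∀ j ∈ J', ∃ h, D j h ∧ (∀ h', D j h' → h ≤ h') ∧ q (MvPolynomial.X j) ∈ S h := by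
    intro j hj
    obtain ⟨h, hD, hmin, -, -, -, hsupp⟩ := hrel j hj
    refine ⟨h, hD, hmin, ?_⟩
    have h1 : q (MvPolynomial.X j) = q (MvPolynomial.monomial (m j) (lam j : A)) :=
      Ideal.Quotient.eq.2 (Ideal.subset_span ⟨j, hj, rfl⟩)
    rw [h1, MvPolynomial.monomial_eq, map_mul, Finsupp.prod, map_prod]
    refine mul_mem ((S h).algebraMap_mem (lam j : A)) (Subalgebra.prod_mem _ fun j' hj' => ?_)
    obtain ⟨i, hi⟩ := hsupp j' hj'
    rw [map_pow]
    exact pow_mem (hS j' h i hi) _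
  have hSmono : Monotone S := by
    refine monotone_nat_of_le_succ fun h => Algebra.adjoin_le ?_
    rintro _ ⟨i, rfl⟩
    have hdi : (deg (idx h i) : Φ) = (c h).e i := by rw [hidx]
    by_cases hE : ∃ i', (c (h + 1)).e i' = deg (idx h i)
    · obtain ⟨i', hi'⟩ := hE
      exact hS _ _ i' hi'
    · have hD : D (idx h i) (h + 1) :=
        ⟨hmono (Nat.le_succ h) (by rw [hdi]; exact (c h).e_mem i), fun i' hi' => hE ⟨i', hi'⟩⟩
      obtain ⟨h₀, hD₀, hmin, hmem⟩ := hS' _ ⟨_, hD⟩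
      -- Had the generator of stage `h` been decomposable at a stage `h₀ ≤ h`, it would remain so at
      -- stage `h`, against irreducibility. So its binomial is written at stage `h + 1` and puts its
      -- class in `S (h + 1)`.
      rcases (hmin _ hD).lt_or_eq with hlt | rfl
      · obtain ⟨a, ha, b, hb, ha0, hb0, hab⟩ := (c h₀).exists_add hD₀.1
          (fun h => (hpos (idx _ i)).ne' (Subtype.ext h)) hD₀.2
        exact absurd (hdi.symm.trans hab) ((c h).ne_add i (hmono (Nat.lt_succ_iff.1 hlt) ha)
          (hmono (Nat.lt_succ_iff.1 hlt) hb) ha0 hb0)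
      · exact hmem
  have hall : ∀ p : MvPolynomial J A, ∃ h, q p ∈ S h := by
    intro p
    induction p using MvPolynomial.induction_on with
    | C a => exact ⟨0, (S 0).algebraMap_mem a⟩
    | add p₁ p₂ h₁ h₂ =>
      obtain ⟨k₁, h₁⟩ := h₁
      obtain ⟨k₂, h₂⟩ := h₂
      rw [map_add]
      exact ⟨max k₁ k₂, add_mem (hSmono (le_max_left _ _) h₁) (hSmono (le_max_right _ _) h₂)⟩
    | mul_X p j h₁ =>
      obtain ⟨k₁, h₁⟩ := h₁
      obtain ⟨k₂, h₂⟩ : ∃ h, q (MvPolynomial.X j) ∈ S h := by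
        obtain ⟨h, hh⟩ := hcov (deg j) (deg j).2
        by_cases hE : ∃ i, (c h).e i = deg j
        · obtain ⟨i, hi⟩ := hE
          exact ⟨h, hS _ _ i hi⟩
        · obtain ⟨h₀, -, -, hmem⟩ := hS' j ⟨h, hh, fun i hi => hE ⟨i, hi⟩⟩
          exact ⟨h₀, hmem⟩
      rw [map_mul]
      exact ⟨max k₁ k₂, mul_mem (hSmono (le_max_left _ _) h₁) (hSmono (le_max_right _ _) h₂)⟩
  -- For `p` in the kernel, its class is a polynomial `s` in the generators of one stage. Their
  -- images in `B` are algebraically independent, so `s = 0` and `p ∈ I`.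
  obtain ⟨h, hh⟩ := hall p
  rw [show S h = _ from Algebra.adjoin_range_eq_range_aeval A _] at hh
  obtain ⟨s, hs⟩ := hh
  replace hs : MvPolynomial.aeval (fun i => q (MvPolynomial.X (idx h i))) s = q p := hs
  let πbar : MvPolynomial J A ⧸ I →ₐ[A] B := Ideal.Quotient.liftₐ I π fun a ha => hIπ ha
  have h1 : MvPolynomial.aeval (T.toGradedPoly (c h)).x s = πbar (q p) := by
    rw [← hs]
    refine Eq.trans ?_ (MvPolynomial.comp_aeval_apply _ πbar s).symm
    have h2 : (T.toGradedPoly (c h)).x = fun i => πbar (q (MvPolynomial.X (idx h i))) := by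
      funext i
      have h3 : πbar (q (MvPolynomial.X (idx h i))) = π (MvPolynomial.X (idx h i)) := rfl
      rw [h3, MvPolynomial.aeval_X]
      exact congrArg T.u (hidx h i).symm
    exact congrArg (fun x => MvPolynomial.aeval x s) h2
  have h2 : πbar (q p) = 0 := hp
  rw [h2] at h1
  have h3 : s = 0 := (T.toGradedPoly (c h)).algInd.eq_zero_of_aeval_eq_zero s h1
  rw [h3, map_zero] at hs
  exact Ideal.Quotient.eq_zero_iff_mem.1 hs.symm

end TermBasis

end BinomialPresentations

/-! ### The graded algebra of a valuation has a term basis. -/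

section GradedAlgebra

variable {K Φ : Type*} [Field K] [AddCommGroup Φ] [LinearOrder Φ] [IsOrderedAddMonoid Φ]
variable (ν : AddValuation K (WithTop Φ))

theorem toGr_mul_of (c : valRing ν) {φ : NonnegPart Φ} (x : valIdeal ν φ) :
    toGr ν c * DirectSum.of (GrComp ν) φ (grMk ν φ x) =
      DirectSum.of (GrComp ν) φ (grMk ν φ (c • x)) := by
  change DirectSum.of (GrComp ν) 0 (grMk ν 0 (toZero ν c)) * _ = _
  rw [DirectSum.of_mul_of]
  exact DirectSum.of_eq_of_gradedMonoid_eq (grMk_heq ν (zero_add φ) _ _ rfl)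

theorem residue_smul (c : valRing ν) (z : GrRing ν) :
    (IsLocalRing.residue (valRing ν) c : ResField ν) • z = toGr ν c * z := by
  rw [Algebra.smul_def]
  rfl

theorem residue_smul_of (c : valRing ν) {φ : NonnegPart Φ} (x : valIdeal ν φ) :
    (IsLocalRing.residue (valRing ν) c : ResField ν) • DirectSum.of (GrComp ν) φ (grMk ν φ x) =
      DirectSum.of (GrComp ν) φ (grMk ν φ (c • x)) := by
  rw [residue_smul, toGr_mul_of]

theorem grMk_eq_zero {φ : NonnegPart Φ} {x : valIdeal ν φ} :
    grMk ν φ x = 0 ↔ ((φ : Φ) : WithTop Φ) < ν ((x : valRing ν) : K) := by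
  have h : grMk ν φ x = 0 ↔ grMk ν φ x = grMk ν φ 0 := Iff.rfl
  rw [h, grMk_eq]
  simp

variable {ν}

theorem residue_eq_zero {c : valRing ν} (hc : 0 < ν (c : K)) :
    IsLocalRing.residue (valRing ν) c = 0 := by
  rw [IsLocalRing.residue_eq_zero_iff, IsLocalRing.mem_maximalIdeal]
  intro hu
  obtain ⟨d, hd⟩ := isUnit_iff_exists_inv.1 hu
  have h1 : ν (c : K) + ν (d : K) = 0 := by
    rw [← ν.map_mul, ← ν.map_one]
    exact congrArg (fun z : valRing ν => ν (z : K)) hd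
  have h2 : (0 : WithTop Φ) ≤ ν (d : K) := d.2
  exact (lt_of_lt_of_le hc (le_add_of_nonneg_right h2)).ne' h1

/-- The classes of elements of `K`, one of each value `φ ≥ 0`, in the components of the graded
algebra. -/
def initialForm {t : NonnegPart Φ → K} (ht : ∀ φ, ν (t φ) = ((φ : Φ) : WithTop Φ))
    (φ : NonnegPart Φ) : GrComp ν φ :=
  grMk ν φ ⟨⟨t φ, by
    change (0 : WithTop Φ) ≤ ν (t φ)
    rw [ht]
    exact_mod_cast φ.2⟩, (ht φ).ge⟩

variable {t : NonnegPart Φ → K} (ht : ∀ φ, ν (t φ) = ((φ : Φ) : WithTop Φ))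

theorem ne_zero_of_val_eq {x : K} {φ : Φ} (h : ν x = (φ : WithTop Φ)) : x ≠ 0 := by
  rintro rfl
  rw [ν.map_zero] at h
  exact WithTop.top_ne_coe h

/-- Every homogeneous element is a multiple of the chosen element of its degree. -/
theorem exists_residue_smul_initialForm {φ : NonnegPart Φ} (x : valIdeal ν φ) :
    ∃ c : valRing ν, DirectSum.of (GrComp ν) φ (grMk ν φ x) =
        (IsLocalRing.residue (valRing ν) c : ResField ν) •
          DirectSum.of (GrComp ν) φ (initialForm ht φ) := by
  have ht0 := ne_zero_of_val_eq (ht φ)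
  have hx : ((φ : Φ) : WithTop Φ) ≤ ν ((x : valRing ν) : K) := x.2
  -- The coefficient is the residue of `x / t φ`, whose value is nonnegative because `ν x ≥ φ`.
  have hv : ν (((x : valRing ν) : K) / t φ) + ((φ : Φ) : WithTop Φ) = ν ((x : valRing ν) : K) := by
    rw [← ht φ, ← ν.map_mul, div_mul_cancel₀ _ ht0]
  have hc : 0 ≤ ν (((x : valRing ν) : K) / t φ) := by
    rw [← hv] at hx
    by_contra! h
    have h1 := WithTop.add_lt_add_of_lt_of_le (WithTop.coe_ne_top (a := (φ : Φ))) h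
      (le_refl ((φ : Φ) : WithTop Φ))
    rw [zero_add] at h1
    exact absurd hx h1.not_ge
  refine ⟨⟨_, hc⟩, ?_⟩
  rw [initialForm, residue_smul_of]
  congr 2
  exact Subtype.ext (Subtype.ext (div_mul_cancel₀ _ ht0).symm)

/-- Distinct members lie in distinct components, so each term vanishes separately. If the lift `r`
of a coefficient satisfies `ν (r * t φ) > φ`, then `ν r > 0` and the residue of `r` is zero. -/
theorem linearIndependent_initialForm :
    LinearIndependent (ResField ν) fun φ => DirectSum.of (GrComp ν) φ (initialForm ht φ) := by
  rw [linearIndependent_iff']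
  intro s g hg φ hφ
  choose r hr using IsLocalRing.residue_surjective (R := valRing ν)
  have h1 : ∀ ψ, g ψ • DirectSum.of (GrComp ν) ψ (initialForm ht ψ) =
      DirectSum.of (GrComp ν) ψ (grMk ν ψ (r (g ψ) • ⟨⟨t ψ, by
        change (0 : WithTop Φ) ≤ ν (t ψ)
        rw [ht]
        exact_mod_cast ψ.2⟩, (ht ψ).ge⟩)) := by
    intro ψ
    rw [← residue_smul_of, hr]
    rfl
  simp only [h1] at hg
  have h2 := congrArg (fun z : GrRing ν => z φ) hg
  simp only [DirectSum.sum_apply, DirectSum.zero_apply] at h2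
  rw [Finset.sum_eq_single φ (fun ψ _ hψ => DirectSum.of_eq_of_ne _ _ _ hψ.symm)
    (fun h => absurd hφ h), DirectSum.of_eq_same, grMk_eq_zero] at h2
  rw [← hr (g φ)]
  apply residue_eq_zero
  change ((φ : Φ) : WithTop Φ) < ν ((r (g φ) : K) * t φ) at h2
  rw [ν.map_mul, ht] at h2
  by_contra h3
  have h4 : ν (r (g φ) : K) + ((φ : Φ) : WithTop Φ) ≤ 0 + ((φ : Φ) : WithTop Φ) :=
    add_le_add (not_lt.1 h3) le_rfl
  rw [zero_add] at h4
  exact absurd h2 h4.not_gt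

theorem span_initialForm : ⊤ ≤ Submodule.span (ResField ν)
    (Set.range fun φ => DirectSum.of (GrComp ν) φ (initialForm ht φ)) := by
  intro z _
  induction z using DirectSum.induction_on with
  | zero => exact zero_mem _
  | of φ a =>
    obtain ⟨x, rfl⟩ := grMk_surj ν a
    obtain ⟨c, h⟩ := exists_residue_smul_initialForm ht x
    rw [h]
    exact Submodule.smul_mem _ _ (Submodule.subset_span ⟨φ, rfl⟩)
  | add x y hx hy => exact add_mem (hx trivial) (hy trivial)

/-- An element of value exactly `φ` has nonzero class in a component spanned by the chosen class.
Applied to `1` and to `t φ * t ψ`, this supplies the constants of the term basis; they are needed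
because `t` need not be multiplicative. -/
theorem exists_unit_smul_initialForm {φ : NonnegPart Φ} (x : valIdeal ν φ)
    (hx : ν ((x : valRing ν) : K) = ((φ : Φ) : WithTop Φ)) :
    ∃ c : (ResField ν)ˣ, DirectSum.of (GrComp ν) φ (initialForm ht φ) =
        (c : ResField ν) • DirectSum.of (GrComp ν) φ (grMk ν φ x) := by
  obtain ⟨c, h⟩ := exists_residue_smul_initialForm ht x
  have hc : (IsLocalRing.residue (valRing ν) c : ResField ν) ≠ 0 := by
    intro h0
    rw [h0, Algebra.smul_def, map_zero, zero_mul] at h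
    have h1 := DirectSum.of_injective (β := GrComp ν) φ
      (h.trans (DirectSum.of (GrComp ν) φ).map_zero.symm)
    rw [grMk_eq_zero, hx] at h1
    exact lt_irrefl _ h1
  refine ⟨(Units.mk0 _ hc)⁻¹, ?_⟩
  rw [h, smul_smul, Units.val_inv_eq_inv_val, Units.val_mk0, inv_mul_cancel₀ hc, one_smul]

/-- Elements of `K`, one of each value `φ ≥ 0`, define a term basis of the graded algebra. -/
def grTermBasis : TermBasis (ResField ν) (grComp ν) ⊤ where
  u := Module.Basis.mk (linearIndependent_initialForm ht) (span_initialForm ht)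
  mem φ := by
    rw [Module.Basis.mk_apply]
    exact ⟨_, rfl⟩
  one := by
    obtain ⟨c, hc⟩ := exists_unit_smul_initialForm ht (toZero ν 1) ν.map_one
    refine ⟨c, trivial, ?_⟩
    rw [Module.Basis.mk_apply, hc]
    rfl
  mul φ ψ := by
    simp only [Module.Basis.mk_apply]
    rw [DirectSum.of_mul_of]
    exact (exists_unit_smul_initialForm ht (φ := φ + ψ) ⟨_, mul_mem_valIdeal ν _ _⟩ (by
      change ν (t φ * t ψ) = _
      rw [ν.map_mul, ht, ht]
      rfl)).imp fun c hc => ⟨trivial, hc⟩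

end GradedAlgebra

end ValGr

end

/-! ### The two statements for `A[t^{Φ₊}]` and `gr_ν R_ν`. -/

theorem proposition4p4 (Φ : Type*) [AddCommGroup Φ] [LinearOrder Φ] [IsOrderedAddMonoid Φ] :
    (ValGr.FiniteHeight Φ → ∀ (A : Type*) [CommRing A],
      ∃ 𝒮 : Set (ValGr.GradedPolySubalgebra A (ValGr.semigroupComp A Φ)),
        ValGr.IsToricDirectLimit 𝒮 ∧
        (∀ S ∈ 𝒮, ∀ i, S.x i = AddMonoidAlgebra.single (S.deg i) (1 : A)) ∧
        (Countable Φ →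
          ∃ c : ℕ → ValGr.GradedPolySubalgebra A (ValGr.semigroupComp A Φ),
            (∀ h, c h ∈ 𝒮) ∧
            (∀ h, ValGr.ToricInclusion (c h) (c (h + 1))) ∧
            (∀ S ∈ 𝒮, ∃ h, S.toSubalgebra ≤ (c h).toSubalgebra)) ∧
        (ValGr.FiniteRationalRank Φ → ∀ S ∈ 𝒮, S.n = ValGr.rationalRank Φ)) ∧
    (ValGr.FiniteRationalRank Φ → ∀ (K : Type*) [Field K] (ν : AddValuation K (WithTop Φ)),
      (∀ φ : Φ, ∃ x : K, ν x = (φ : WithTop Φ)) →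
        ValGr.HasBinomialPresentation (ValGr.ResField ν) (ValGr.grComp ν) ∧
        ∃ c : ℕ → ValGr.GradedPolySubalgebra (ValGr.ResField ν) (ValGr.grComp ν),
          (∀ h, (c h).n = ValGr.rationalRank Φ) ∧
          (∀ h, ValGr.TermInclusion (c h) (c (h + 1))) ∧
          (∀ z : ValGr.GrRing ν, ∃ h, z ∈ (c h).toSubalgebra)) := by
  refine ⟨fun _ A _ => ?_, fun hr K _ ν hν => ?_⟩
  · let T := ValGr.semigroupTermBasis A Φ
    refine ⟨Set.range T.toGradedPoly, T.isToricDirectLimit, ?_, fun _ => ?_, ?_⟩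
    · rintro _ ⟨P, rfl⟩ i
      exact ValGr.semigroupTermBasis_u A _
    · obtain ⟨c, hc, hc'⟩ := ValGr.exists_monotone_posFamily (Φ := Φ)
      refine ⟨fun h => T.toGradedPoly (c h), fun h => ⟨_, rfl⟩,
        fun h => T.toricInclusion (hc (Nat.le_succ h)), ?_⟩
      rintro _ ⟨P, rfl⟩
      -- Cofinality: the finitely many generators of `P` all lie in the monoid of one stage.
      obtain ⟨h, hh⟩ := ValGr.PosFamily.exists_monoid_of_finset hc hc'
        (Finset.univ.image fun i => (⟨P.e i, (P.pos i).le⟩ : ValGr.NonnegPart Φ))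
      exact ⟨h, T.toSubalgebra_le (ValGr.PosFamily.monoid_le fun i =>
        hh _ (Finset.mem_image_of_mem _ (Finset.mem_univ i)))⟩
    · rintro h _ ⟨P, rfl⟩
      exact P.card_eq h
  · have := ValGr.countable_of_finiteRationalRank hr
    choose t ht using fun φ : ValGr.NonnegPart Φ => hν φ
    let T := ValGr.grTermBasis ht
    refine ⟨T.hasBinomialPresentation, ?_⟩
    obtain ⟨c, hc, hc'⟩ := ValGr.exists_monotone_posFamily (Φ := Φ)
    refine ⟨fun h => T.toGradedPoly (c h), fun h => (c h).card_eq hr,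
      fun h => T.termInclusion (hc (Nat.le_succ h)), fun z => ?_⟩
    obtain ⟨h, hh⟩ := ValGr.PosFamily.exists_monoid_of_finset hc hc' (T.u.repr z).support
    exact ⟨h, T.mem_toSubalgebra hh⟩
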